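/- Let $n\ge 1$ and let $Z=(Z_1,\dots,Z_n)$ have i.i.d. $N(0,\sigma^2)$ coordinates, $\sigma>0$. An infinite constellation (IC) is a nonempty set $S\subset\mathbb R^n$ that has finitely many points in each cube $\mathrm{Cb}(a)=\{x:|x_i|<a/2\ \forall i\}$. Put $M(S,a)=|S\cap \mathrm{Cb}(a)|$, $\mathbb E_a[f]=\frac1{M(S,a)}\sum_{s\in S\cap \mathrm{Cb}(a)}f(s)$, let $\gamma(S)=\limsup_{a\to\infty}M(S,a)/a^n\in[0,\infty]$ be the density and, if $0<\gamma(S)<\infty$, let $\delta(S)=\frac1n\log\gamma(S)$. Let $W(s)=\{x:\|x-s\|\le\|x-t\|\ \forall t\in S\}$ be the Voronoi cell of $s\in S$, $P_e(s)=\Pr\{s+Z\notin W(s)\}$, and let $P_e(S)=\limsup_{a\to\infty}\mathbb E_a[P_e(s)]$ be the average error probability. Let $V_n$ be the volume of the unit ball. For $v\in[0,\infty]$ let $\mathrm{SPB}(v)=\Pr\{\|Z\|>(v/V_n)^{1/n}\}$ be the probability that $Z$ leaves the centred ball of volume $v$. An IC is regular if there is $r_0>0$ such that $W(s)$ lies in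 the open ball of radius $r_0$ about $s$ for all $s\in S$, and $M(S,a)/a^n\to\gamma(S)$ as $a\to\infty$; put $v(S)=\limsup_{a\to\infty}\mathbb E_a[|W(s)|]$, where $|\cdot|$ is volume. The conventions $1/0=\infty$, $1/\infty=0$ are used. Then: 1. For every IC $S$ (lattice or not) with density $\gamma=\gamma(S)$, $P_e(S)\ge \mathrm{SPB}(1/\gamma)$. If $0<\gamma<\infty$, then $\mathrm{SPB}(1/\gamma)=\Pr\{\|Z\|>r_{\mathrm{eff}}\}$, where $r_{\mathrm{eff}}=e^{-\delta(S)}V_n^{-1/n}$ is the radius of a ball of volume $1/\gamma$. 2. For every regular IC $S$, $\gamma(S)=1/v(S)$. 3. $\mathrm{SPB}$ is convex on $[0,\infty)$. 4. For every regular IC $S$, $P_e(S)\ge\mathrm{SPB}(v(S))=\mathrm{SPB}(1/\gamma(S))$. 5. For every IC $S$ with $0<\gamma(S)<\infty$ and every $\xi>0$ there is a regular IC $S'$ with $\gamma(S')\ge\gamma(S)/(1+\xi)$ and $P_e(S')\le(1+\xi)P_e(S)$. -/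

import Mathlib

open Set Filter Topology MeasureTheory ProbabilityTheory
open scoped NNReal ENNReal

namespace InfConst

noncomputable section

/-- The open hypercube `{x : ∀ i, |x i| < a / 2}` of edge length `a` centred at the origin. -/
def cube (n : ℕ) (a : ℝ) : Set (EuclideanSpace ℝ (Fin n)) :=
  {x | ∀ i, |x i| < a / 2}

/-- An infinite constellation: a nonempty set of points of which every cube contains only
finitely many. -/
def IsIC {n : ℕ} (S : Set (EuclideanSpace ℝ (Fin n))) : Prop :=
  S.Nonempty ∧ ∀ a : ℝ, (S ∩ cube n a).Finite

/-- `M(S, a)`, the number of points of `S` in the cube of edge length `a`. -/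
def numPoints {n : ℕ} (S : Set (EuclideanSpace ℝ (Fin n))) (a : ℝ) : ℝ≥0∞ :=
  ((S ∩ cube n a).encard : ℝ≥0∞)

/-- The density `γ(S) = limsup_{a → ∞} M(S, a) / a ^ n`. -/
def density {n : ℕ} (S : Set (EuclideanSpace ℝ (Fin n))) : ℝ≥0∞ :=
  limsup (fun a : ℝ => numPoints S a / ENNReal.ofReal a ^ n) atTop

/-- The normalized log density `δ = (1 / n) log γ`
(meaningful when the density is positive and finite). -/
def nld {n : ℕ} (S : Set (EuclideanSpace ℝ (Fin n))) : ℝ :=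
  1 / (n : ℝ) * Real.log (density S).toReal

/-- `𝔼_a[f(s)]`: the average of `f` over the points of `S` in the cube of edge length `a`. -/
def cubeAverage {n : ℕ} (S : Set (EuclideanSpace ℝ (Fin n))) (a : ℝ)
    (f : EuclideanSpace ℝ (Fin n) → ℝ≥0∞) : ℝ≥0∞ :=
  (∑' s : ↥(S ∩ cube n a), f s) / numPoints S a

/-- The (closed) Voronoi region of `s`. For an infinite constellation its boundary is a Lebesgue
null set, and replacing it by the open cell can only increase the error probability. -/
def voronoi {n : ℕ} (S : Set (EuclideanSpace ℝ (Fin n))) (s : EuclideanSpace ℝ (Fin n)) :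
    Set (EuclideanSpace ℝ (Fin n)) :=
  {x | ∀ t ∈ S, dist x s ≤ dist x t}

/-- The law of the noise `Z = (Z_1, …, Z_n)` with i.i.d. coordinates `Z_i ~ N(0, σ²)`. -/
def noise (n : ℕ) (σ : ℝ≥0) : Measure (EuclideanSpace ℝ (Fin n)) :=
  (Measure.pi fun _ : Fin n => gaussianReal 0 (σ ^ 2)).map (WithLp.toLp 2)

/-- The error probability `P_e(s) = Pr{s + Z ∉ W(s)}` of maximum likelihood decoding. -/
def errorProb {n : ℕ} (σ : ℝ≥0) (S : Set (EuclideanSpace ℝ (Fin n)))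
    (s : EuclideanSpace ℝ (Fin n)) : ℝ≥0∞ :=
  noise n σ {z | s + z ∉ voronoi S s}

/-- The average error probability `P_e(S) = limsup_{a → ∞} 𝔼_a[P_e(s)]`. -/
def avgErrorProb {n : ℕ} (σ : ℝ≥0) (S : Set (EuclideanSpace ℝ (Fin n))) : ℝ≥0∞ :=
  limsup (fun a : ℝ => cubeAverage S a (errorProb σ S)) atTop

/-- `V_n`, the volume of the unit ball of `ℝⁿ`. -/
def unitBallVol (n : ℕ) : ℝ≥0∞ :=
  volume (Metric.ball (0 : EuclideanSpace ℝ (Fin n)) 1)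

/-- The radius `(v / V_n) ^ (1 / n)` of a ball of volume `v` in `ℝⁿ`
(`0` for `v = 0` and `∞` for `v = ∞`, when `n ≥ 1`). -/
def ballRadius (n : ℕ) (v : ℝ≥0∞) : ℝ≥0∞ :=
  (v / unitBallVol n) ^ (1 / (n : ℝ))

/-- `SPB(v)`, the probability that the noise leaves a centred ball of volume `v`. -/
def SPB (n : ℕ) (σ : ℝ≥0) (v : ℝ≥0∞) : ℝ≥0∞ :=
  noise n σ {z | ballRadius n v < ‖z‖ₑ}

/-- The effective radius `r_eff = e ^ (-δ) V_n ^ (-1 / n)` at normalized log density `δ`. -/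
def effRadius (n : ℕ) (δ : ℝ) : ℝ :=
  Real.exp (-δ) * (unitBallVol n).toReal ^ (-1 / (n : ℝ))

/-- The sphere bound `P_e^{SB}(n, δ) = Pr{‖Z‖ > r_eff}`. -/
def sphereBound (n : ℕ) (σ : ℝ≥0) (δ : ℝ) : ℝ≥0∞ :=
  noise n σ {z | effRadius n δ < ‖z‖}

/-- Regular infinite constellations: the Voronoi cells are uniformly bounded, and the density
is a limit. -/
def IsRegular {n : ℕ} (S : Set (EuclideanSpace ℝ (Fin n))) : Prop :=
  IsIC S ∧
  (∃ r₀ : ℝ, 0 < r₀ ∧ ∀ s ∈ S, voronoi S s ⊆ Metric.ball s r₀) ∧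
  Tendsto (fun a : ℝ => numPoints S a / ENNReal.ofReal a ^ n) atTop (𝓝 (density S))

/-- The average Voronoi cell volume `v(S) = limsup_{a → ∞} 𝔼_a[|W(s)|]`. -/
def avgVoronoiVol {n : ℕ} (S : Set (EuclideanSpace ℝ (Fin n))) : ℝ≥0∞ :=
  limsup (fun a : ℝ => cubeAverage S a (fun s => volume (voronoi S s))) atTop

end

end InfConst

/-! Sphere bound: intersect the Voronoi cells of the `M` points of `S` in a cube of edge `a` with
balls of radius `r`, and recentre them at the origin. The average `h` of their indicators takes
values in `[0, 1]`. Since cells overlap only in null sets and the truncated ones lie in the cube of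
edge `a + 2r`, `∫ h ≤ (a + 2r)^n / M`. The Gaussian density decreases with the norm, so by the
bathtub principle the average probability of correct decoding is at most the noise mass of a ball of
that volume, up to the tail beyond `r`. Let `a → ∞` where the density is nearly attained, then `r →
∞`, and use right-continuity of `SPB`. The averaging takes place before the bathtub step, so no
Jensen argument is needed. Convexity of `SPB` is the same principle applied to a mixture of two ball
indicators (`lintegral_noise_add_SPB_le`).

For a regular constellation, cells of radius below `r` that start in a cube cover a slightly smaller
cube and stay in a slightly larger one, which gives `v(S) = 1/γ(S)`.

For regularization, choose one large cube with nearly the right density and average error, and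
repeat its points periodically with a guard gap `b` between blocks. The new neighbours matter only
when `‖Z‖ ≥ b/2`, and the gap costs little density when `a` is large compared with `b`. -/

namespace InfConst

/-! ### The Gaussian noise as a radially decreasing density -/

/-- The density of `noise n σ` with respect to Lebesgue measure. -/
noncomputable def noiseDensity (n : ℕ) (σ : ℝ≥0) (x : EuclideanSpace ℝ (Fin n)) : ℝ≥0∞ :=
  ∏ i, gaussianPDF 0 (σ ^ 2) (x i)

theorem lintegral_pi_prod (n : ℕ) (f : Fin n → ℝ → ℝ≥0∞) (hf : ∀ i, Measurable (f i)) :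
    ∫⁻ x : Fin n → ℝ, ∏ i, f i (x i) = ∏ i, ∫⁻ t, f i t := by
  induction n with
  | zero => simp [volume_pi]
  | succ n ih =>
    have hm : ∀ {m : ℕ} (f : Fin m → ℝ → ℝ≥0∞), (∀ i, Measurable (f i)) →
        Measurable fun x : Fin m → ℝ => ∏ i, f i (x i) := fun f hf =>
      Finset.measurable_prod _ fun i _ => (hf i).comp (measurable_pi_apply i)
    rw [Fin.prod_univ_succ, ← ih _ fun i => hf _,
      ← ((volume_preserving_piFinSuccAbove (fun _ : Fin (n + 1) => ℝ) 0).symm).lintegral_comp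
        (hm f hf)]
    simp only [Fin.prod_univ_succ]
    rw [← lintegral_prod_mul (hf 0).aemeasurable
      (hm _ fun i => hf _).aemeasurable]
    rfl

theorem pi_gaussianReal_eq_withDensity (n : ℕ) {v : ℝ≥0} (hv : v ≠ 0) :
    (Measure.pi fun _ : Fin n => gaussianReal 0 v) =
      (volume : Measure (Fin n → ℝ)).withDensity fun x => ∏ i, gaussianPDF 0 v (x i) := by
  refine Measure.pi_eq fun s hs => ?_
  rw [withDensity_apply _ (MeasurableSet.univ_pi hs),
    ← lintegral_indicator (MeasurableSet.univ_pi hs)]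
  have h : (pi univ s).indicator (fun x : Fin n → ℝ => ∏ i, gaussianPDF 0 v (x i)) =
      fun x => ∏ i, (s i).indicator (gaussianPDF 0 v) (x i) := by
    ext x
    by_cases hx : x ∈ pi univ s
    · rw [indicator_of_mem hx]
      exact Finset.prod_congr rfl fun i _ => (indicator_of_mem (hx i (mem_univ i)) _).symm
    · rw [indicator_of_notMem hx]
      simp only [Set.mem_pi, mem_univ, true_implies, not_forall] at hx
      obtain ⟨i, hi⟩ := hx
      exact (Finset.prod_eq_zero (Finset.mem_univ i) (indicator_of_notMem hi _)).symm
  rw [h, lintegral_pi_prod _ _ fun i => (measurable_gaussianPDF 0 v).indicator (hs i)]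
  refine Finset.prod_congr rfl fun i _ => ?_
  rw [lintegral_indicator (hs i), gaussianReal_apply 0 hv]

theorem measurable_noiseDensity (n : ℕ) (σ : ℝ≥0) : Measurable (noiseDensity n σ) :=
  Finset.measurable_prod _ fun i _ => (measurable_gaussianPDF 0 _).comp (by fun_prop)

theorem noise_eq_withDensity (n : ℕ) {σ : ℝ≥0} (hσ : 0 < σ) :
    noise n σ = volume.withDensity (noiseDensity n σ) := by
  have hv : σ ^ 2 ≠ 0 := by positivity
  rw [noise, pi_gaussianReal_eq_withDensity n hv]
  ext s hs
  rw [Measure.map_apply (by fun_prop) hs, withDensity_apply _ hs,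
    withDensity_apply _ (hs.preimage (by fun_prop)),
    ← (PiLp.volume_preserving_toLp (Fin n)).setLIntegral_comp_preimage hs
      (measurable_noiseDensity n σ)]
  rfl

theorem noiseDensity_eq (n : ℕ) (σ : ℝ≥0) (x : EuclideanSpace ℝ (Fin n)) :
    noiseDensity n σ x =
      ENNReal.ofReal ((√(2 * Real.pi * (σ ^ 2 : ℝ≥0)))⁻¹ ^ n *
        Real.exp (-‖x‖ ^ 2 / (2 * (σ ^ 2 : ℝ≥0)))) := by
  simp only [noiseDensity, gaussianPDF, gaussianPDFReal_def]
  rw [← ENNReal.ofReal_prod_of_nonneg fun i _ => by positivity, Finset.prod_mul_distrib,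
    ← Real.exp_sum, EuclideanSpace.norm_sq_eq]
  simp [neg_div, Finset.sum_div]

theorem noiseDensity_le_of_norm_le {n : ℕ} {σ : ℝ≥0} {x y : EuclideanSpace ℝ (Fin n)}
    (h : ‖x‖ ≤ ‖y‖) : noiseDensity n σ y ≤ noiseDensity n σ x := by
  rw [noiseDensity_eq, noiseDensity_eq]
  gcongr

theorem noiseDensity_pos {n : ℕ} {σ : ℝ≥0} (hσ : 0 < σ) (x : EuclideanSpace ℝ (Fin n)) :
    0 < noiseDensity n σ x :=
  pos_iff_ne_zero.2 <| Finset.prod_ne_zero_iff.2 fun _ _ =>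
    (gaussianPDF_pos 0 (by positivity) _).ne'

instance isProbabilityMeasure_noise (n : ℕ) (σ : ℝ≥0) : IsProbabilityMeasure (noise n σ) :=
  Measure.isProbabilityMeasure_map (by fun_prop)

theorem noise_pos_of_isOpen {n : ℕ} {σ : ℝ≥0} (hσ : 0 < σ) {U : Set (EuclideanSpace ℝ (Fin n))}
    (hU : IsOpen U) (hne : U.Nonempty) : 0 < noise n σ U := by
  have hac : volume ≪ noise n σ := by
    rw [noise_eq_withDensity n hσ]
    exact withDensity_absolutelyContinuous' (measurable_noiseDensity n σ).aemeasurable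
      (ae_of_all _ fun x => (noiseDensity_pos hσ x).ne')
  exact pos_iff_ne_zero.2 fun h => (hU.measure_pos volume hne).ne' (hac h)

/-! ### The bathtub principle -/

/-- Bathtub principle: for a density that decreases in the norm of its argument, the weighted
mass of a weight function with values in `[0, 1]` is at most the mass of a centred ball
of volume at least the integral of the weight. -/
theorem lintegral_mul_le_setLIntegral_closedBall {E : Type*} [NormedAddCommGroup E]
    [MeasurableSpace E] [OpensMeasurableSpace E] {μ : Measure E} {g h : E → ℝ≥0∞}
    (hg : Measurable g) (hh : Measurable h)
    (hone : ∀ x, h x ≤ 1) {R : ℝ} {c : ℝ≥0∞}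
    (hcin : ∀ x, ‖x‖ ≤ R → c ≤ g x) (hcout : ∀ x, R < ‖x‖ → g x ≤ c)
    (hfin : μ (Metric.closedBall 0 R) ≠ ∞) (hint : ∫⁻ x, h x ∂μ ≤ μ (Metric.closedBall 0 R)) :
    ∫⁻ x, g x * h x ∂μ ≤ ∫⁻ x in Metric.closedBall 0 R, g x ∂μ := by
  set B : Set E := Metric.closedBall 0 R
  have hB : MeasurableSet B := Metric.isClosed_closedBall.measurableSet
  have hh' : Measurable fun x => 1 - h x := measurable_const.sub hh
  have hhB : ∫⁻ x in B, h x ∂μ ≠ ∞ :=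
    ((setLIntegral_le_lintegral _ _).trans hint |>.trans_lt hfin.lt_top).ne
  have hsplit : ∫⁻ x in B, (1 - h x) ∂μ + ∫⁻ x in B, h x ∂μ = μ B := by
    rw [← lintegral_add_right _ hh]
    simp [tsub_add_cancel_of_le (hone _)]
  -- The weight outside the ball fits into the room left inside. Moving it there at the threshold
  -- level `c` cannot decrease the integral.
  have hout : ∫⁻ x in Bᶜ, h x ∂μ ≤ ∫⁻ x in B, (1 - h x) ∂μ := by
    refine ENNReal.le_of_add_le_add_right hhB ?_
    rw [hsplit, add_comm, lintegral_add_compl _ hB]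
    exact hint
  calc ∫⁻ x, g x * h x ∂μ
      = ∫⁻ x in B, g x * h x ∂μ + ∫⁻ x in Bᶜ, g x * h x ∂μ := (lintegral_add_compl _ hB).symm
    _ ≤ ∫⁻ x in B, g x * h x ∂μ + ∫⁻ x in Bᶜ, c * h x ∂μ := by
        refine add_le_add_right (setLIntegral_mono (hh.const_mul c) fun x hx => ?_) _
        gcongr
        exact hcout x (by simpa [B] using hx)
    _ ≤ ∫⁻ x in B, g x * h x ∂μ + ∫⁻ x in B, c * (1 - h x) ∂μ := by
        rw [lintegral_const_mul _ hh, lintegral_const_mul _ hh']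
        gcongr
    _ ≤ ∫⁻ x in B, g x * h x ∂μ + ∫⁻ x in B, g x * (1 - h x) ∂μ := by
        refine add_le_add_right
          (setLIntegral_mono (hg.mul hh') fun x hx => ?_) _
        exact mul_le_mul_left (hcin x (by simpa [B] using hx)) _
    _ = ∫⁻ x in B, g x ∂μ := by
        rw [← lintegral_add_left (f := fun x => g x * h x) (hg.mul hh)]
        simp [← mul_add, add_tsub_cancel_of_le (hone _)]

/-! ### The function `SPB`: ball radii, convexity, right-continuity -/

theorem unitBallVol_ne_zero (n : ℕ) : unitBallVol n ≠ 0 :=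
  (Metric.measure_ball_pos volume _ one_pos).ne'

theorem unitBallVol_ne_top (n : ℕ) : unitBallVol n ≠ ∞ := measure_ball_lt_top.ne

theorem ballRadius_ne_top {n : ℕ} {v : ℝ≥0∞} (hv : v ≠ ∞) : ballRadius n v ≠ ∞ :=
  ENNReal.rpow_ne_top_of_nonneg (by positivity) (ENNReal.div_ne_top hv (unitBallVol_ne_zero n))

theorem ballRadius_mono (n : ℕ) : Monotone (ballRadius n) := fun _ _ h =>
  ENNReal.rpow_le_rpow (ENNReal.div_le_div_right h _) (by positivity)

theorem continuous_ballRadius (n : ℕ) : Continuous (ballRadius n) :=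
  ENNReal.continuous_rpow_const.comp (ENNReal.continuous_div_const _ (unitBallVol_ne_zero n))

theorem volume_closedBall_ballRadius {n : ℕ} (hn : 0 < n) {v : ℝ≥0∞} (hv : v ≠ ∞) :
    volume (Metric.closedBall (0 : EuclideanSpace ℝ (Fin n)) (ballRadius n v).toReal) = v := by
  rw [Measure.addHaar_closedBall _ _ ENNReal.toReal_nonneg, finrank_euclideanSpace_fin,
    ENNReal.ofReal_pow ENNReal.toReal_nonneg, ENNReal.ofReal_toReal (ballRadius_ne_top hv),
    ballRadius, ← ENNReal.rpow_natCast, ← ENNReal.rpow_mul, one_div,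
    inv_mul_cancel₀ (by positivity), ENNReal.rpow_one]
  exact ENNReal.div_mul_cancel (unitBallVol_ne_zero n) (unitBallVol_ne_top n)

theorem setOf_lt_enorm_eq {E : Type*} [SeminormedAddCommGroup E] {r : ℝ≥0∞} (hr : r ≠ ∞) :
    {z : E | r < ‖z‖ₑ} = (Metric.closedBall 0 r.toReal)ᶜ := by
  ext z
  rw [mem_ofPred_eq, mem_compl_iff, mem_closedBall_zero_iff, not_le, ← ofReal_norm,
    ENNReal.lt_ofReal_iff_toReal_lt hr]

theorem SPB_antitone (n : ℕ) (σ : ℝ≥0) : Antitone (SPB n σ) := fun _ _ h =>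
  measure_mono fun _ hz => (ballRadius_mono n h).trans_lt hz

theorem SPB_top {n : ℕ} (hn : 0 < n) (σ : ℝ≥0) : SPB n σ ∞ = 0 := by
  have : ballRadius n ∞ = ∞ := by
    rw [ballRadius, ENNReal.top_div_of_ne_top (unitBallVol_ne_top n)]
    exact ENNReal.top_rpow_of_pos (by positivity)
  simp [SPB, this]

theorem noise_closedBall_add_SPB {n : ℕ} (σ : ℝ≥0) {v : ℝ≥0∞} (hv : v ≠ ∞) :
    noise n σ (Metric.closedBall 0 (ballRadius n v).toReal) + SPB n σ v = 1 := by
  rw [SPB, setOf_lt_enorm_eq (ballRadius_ne_top hv)]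
  exact prob_add_prob_compl Metric.isClosed_closedBall.measurableSet

theorem SPB_pos {n : ℕ} (hn : 0 < n) {σ : ℝ≥0} (hσ : 0 < σ) {v : ℝ≥0∞} (hv : v ≠ ∞) :
    0 < SPB n σ v := by
  rw [SPB, setOf_lt_enorm_eq (ballRadius_ne_top hv)]
  refine noise_pos_of_isOpen hσ Metric.isClosed_closedBall.isOpen_compl ?_
  have : Nonempty (Fin n) := ⟨⟨0, hn⟩⟩
  obtain ⟨x, hx⟩ := NormedSpace.exists_lt_norm ℝ (EuclideanSpace ℝ (Fin n)) (ballRadius n v).toReal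
  exact ⟨x, by simpa using hx⟩

theorem lintegral_noise_add_SPB_le {n : ℕ} (hn : 0 < n) {σ : ℝ≥0} (hσ : 0 < σ) {v : ℝ≥0∞}
    (hv : v ≠ ∞) {h : EuclideanSpace ℝ (Fin n) → ℝ≥0∞} (hh : Measurable h)
    (hone : ∀ x, h x ≤ 1) (hint : ∫⁻ x, h x ≤ v) :
    ∫⁻ x, h x ∂(noise n σ) + SPB n σ v ≤ 1 := by
  rw [← noise_closedBall_add_SPB σ hv]
  refine add_le_add_left ?_ _
  have : Nonempty (Fin n) := ⟨⟨0, hn⟩⟩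
  have hvol := volume_closedBall_ballRadius hn hv
  set R := (ballRadius n v).toReal
  -- The threshold `c` is the noise density at any point of the sphere of radius `R`.
  obtain ⟨x₀, hx₀⟩ : ∃ x₀ : EuclideanSpace ℝ (Fin n), ‖x₀‖ = R :=
    ⟨EuclideanSpace.single ⟨0, hn⟩ R, by simp [R]⟩
  rw [noise_eq_withDensity n hσ, lintegral_withDensity_eq_lintegral_mul _
    (measurable_noiseDensity n σ) hh, withDensity_apply _ Metric.isClosed_closedBall.measurableSet]
  exact lintegral_mul_le_setLIntegral_closedBall (measurable_noiseDensity n σ) hh hone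
    (fun x hx => noiseDensity_le_of_norm_le (hx.trans hx₀.ge))
    (fun x hx => noiseDensity_le_of_norm_le (hx₀.le.trans hx.le)) (hvol.trans_ne hv)
    (hint.trans hvol.ge)

theorem SPB_ne_top (n : ℕ) (σ : ℝ≥0) (v : ℝ≥0∞) : SPB n σ v ≠ ∞ := measure_ne_top _ _

/-- The weight `a·1_{B v} + b·1_{B w}` has integral `a v + b w`, so its noise mass is at most that
of the ball of this volume: ball mass is concave in the volume. -/
theorem convexOn_SPB {n : ℕ} (hn : 0 < n) {σ : ℝ≥0} (hσ : 0 < σ) :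
    ConvexOn ℝ (Ici 0) fun v : ℝ => (SPB n σ (ENNReal.ofReal v)).toReal := by
  refine ⟨convex_Ici 0, fun v hv w hw a b ha hb hab => ?_⟩
  set B : ℝ → Set (EuclideanSpace ℝ (Fin n)) := fun v =>
    Metric.closedBall 0 (ballRadius n (ENNReal.ofReal v)).toReal
  have hB : ∀ v, MeasurableSet (B v) := fun v => Metric.isClosed_closedBall.measurableSet
  have hvol : ∀ v, volume (B v) = ENNReal.ofReal v := fun v =>
    volume_closedBall_ballRadius hn ENNReal.ofReal_ne_top
  have hprob : ∀ v, (noise n σ (B v)).toReal = 1 - (SPB n σ (ENNReal.ofReal v)).toReal := by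
    intro v
    rw [eq_sub_iff_add_eq, ← ENNReal.toReal_add (measure_ne_top _ _) (SPB_ne_top _ _ _),
      noise_closedBall_add_SPB σ ENNReal.ofReal_ne_top, ENNReal.toReal_one]
  have hmeas : ∀ (c : ℝ≥0∞) v, Measurable ((B v).indicator fun _ => c) := fun c v =>
    measurable_const.indicator (hB v)
  have key := lintegral_noise_add_SPB_le hn hσ (v := ENNReal.ofReal (a * v + b * w))
    ENNReal.ofReal_ne_top
    (h := fun x => (B v).indicator (fun _ => ENNReal.ofReal a) x +
      (B w).indicator (fun _ => ENNReal.ofReal b) x)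
    ((hmeas _ v).add (hmeas _ w)) (fun x => by
      calc _ ≤ ENNReal.ofReal a + ENNReal.ofReal b :=
            add_le_add (indicator_le_self' (by simp) x) (indicator_le_self' (by simp) x)
        _ = 1 := by rw [← ENNReal.ofReal_add ha hb, hab, ENNReal.ofReal_one])
    (by
      rw [lintegral_add_left (hmeas _ v), lintegral_indicator_const (hB v),
        lintegral_indicator_const (hB w), hvol, hvol, ← ENNReal.ofReal_mul ha,
        ← ENNReal.ofReal_mul hb, ENNReal.ofReal_add (mul_nonneg ha hv) (mul_nonneg hb hw)])
  rw [lintegral_add_left (hmeas _ v), lintegral_indicator_const (hB v),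
    lintegral_indicator_const (hB w)] at key
  have key' := ENNReal.toReal_mono ENNReal.one_ne_top key
  have h1 : ENNReal.ofReal a * noise n σ (B v) ≠ ∞ :=
    ENNReal.mul_ne_top ENNReal.ofReal_ne_top (measure_ne_top _ _)
  have h2 : ENNReal.ofReal b * noise n σ (B w) ≠ ∞ :=
    ENNReal.mul_ne_top ENNReal.ofReal_ne_top (measure_ne_top _ _)
  rw [ENNReal.toReal_add (ENNReal.add_ne_top.2 ⟨h1, h2⟩) (SPB_ne_top _ _ _),
    ENNReal.toReal_add h1 h2, ENNReal.toReal_mul, ENNReal.toReal_mul, ENNReal.toReal_ofReal ha,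
    ENNReal.toReal_ofReal hb, hprob, hprob, ENNReal.toReal_one] at key'
  simp only [smul_eq_mul]
  linarith

/-- Right-continuity of the sphere bound as a function of the volume. -/
theorem SPB_le_of_forall_gt {n : ℕ} {σ : ℝ≥0} {v p : ℝ≥0∞} (hv : v ≠ ∞)
    (h : ∀ w, v < w → w ≠ ∞ → SPB n σ w ≤ p) : SPB n σ v ≤ p := by
  obtain ⟨w, hanti, hmem, hlim⟩ := exists_seq_strictAnti_tendsto' hv.lt_top
  -- The strict inequality makes the exteriors for `w k ↓ v` increase to the exterior for `v`.
  have hU : {z : EuclideanSpace ℝ (Fin n) | ballRadius n v < ‖z‖ₑ} =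
      ⋃ k, {z | ballRadius n (w k) < ‖z‖ₑ} := by
    ext z
    simp only [mem_ofPred_eq, mem_iUnion]
    refine ⟨fun hz => ?_, fun ⟨k, hk⟩ => (ballRadius_mono n (hmem k).1.le).trans_lt hk⟩
    exact (((continuous_ballRadius n).tendsto v).comp hlim |>.eventually_lt_const hz).exists
  rw [SPB, hU, Monotone.measure_iUnion]
  · exact iSup_le fun k => h _ (hmem k).1 (hmem k).2.ne
  · exact fun i j hij z hz => (ballRadius_mono n (hanti.antitone hij)).trans_lt hz

theorem SPB_inv_density_eq_sphereBound {n : ℕ} (σ : ℝ≥0)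
    {S : Set (EuclideanSpace ℝ (Fin n))} (h0 : 0 < density S) (ht : density S < ∞) :
    SPB n σ (density S)⁻¹ = sphereBound n σ (nld S) := by
  have hv : (density S)⁻¹ ≠ ∞ := ENNReal.inv_ne_top.2 h0.ne'
  have hγ : 0 < (density S).toReal := ENNReal.toReal_pos h0.ne' ht.ne
  have hR : (ballRadius n (density S)⁻¹).toReal = effRadius n (nld S) := by
    rw [ballRadius, ← ENNReal.toReal_rpow, ENNReal.toReal_div, ENNReal.toReal_inv, effRadius, nld,
      Real.div_rpow (by positivity) ENNReal.toReal_nonneg, neg_div,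
      Real.rpow_neg ENNReal.toReal_nonneg, ← div_eq_mul_inv, Real.inv_rpow hγ.le, Real.exp_neg,
      Real.rpow_def_of_pos hγ, mul_comm (1 / (n : ℝ))]
  rw [SPB, sphereBound, setOf_lt_enorm_eq (ballRadius_ne_top hv), hR]
  congr 1
  ext z
  simp

/-! ### Noise tails, cubes and Voronoi cells -/

theorem tendsto_noise_tail (n : ℕ) (σ : ℝ≥0) :
    Tendsto (fun k : ℕ => noise n σ (Metric.ball 0 k)ᶜ) atTop (𝓝 0) := by
  have h : ⋂ k : ℕ, (Metric.ball (0 : EuclideanSpace ℝ (Fin n)) k)ᶜ = ∅ := by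
    rw [← compl_iUnion, Metric.iUnion_ball_nat, compl_univ]
  rw [← measure_empty (μ := noise n σ), ← h]
  exact tendsto_measure_iInter_atTop
    (fun k => Metric.isOpen_ball.measurableSet.compl.nullMeasurableSet)
    (fun i j hij => compl_subset_compl.2 (Metric.ball_subset_ball (by exact_mod_cast hij)))
    ⟨0, measure_ne_top _ _⟩

theorem numPoints_eq_card {n : ℕ} {S : Set (EuclideanSpace ℝ (Fin n))} {a : ℝ}
    (h : (S ∩ cube n a).Finite) : numPoints S a = (h.toFinset.card : ℝ≥0∞) := by
  rw [numPoints, h.encard_eq_coe_toFinset_card]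
  simp

theorem cubeAverage_eq_sum_div {n : ℕ} {S : Set (EuclideanSpace ℝ (Fin n))} {a : ℝ}
    (h : (S ∩ cube n a).Finite) (f : EuclideanSpace ℝ (Fin n) → ℝ≥0∞) :
    cubeAverage S a f = (∑ s ∈ h.toFinset, f s) / numPoints S a := by
  rw [cubeAverage, ← Finset.tsum_subtype]
  congr 1
  exact (Equiv.setCongr (by ext; simp : S ∩ cube n a = {x | x ∈ h.toFinset})).tsum_eq
    (fun s : {x | x ∈ h.toFinset} => f s)

theorem cube_eq_preimage (n : ℕ) (a : ℝ) :
    cube n a = WithLp.ofLp ⁻¹' (univ.pi fun _ : Fin n => Ioo (-(a / 2)) (a / 2)) := by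
  ext x
  simp [cube, abs_lt]

theorem volume_cube (n : ℕ) (a : ℝ) : volume (cube n a) = ENNReal.ofReal a ^ n := by
  rw [cube_eq_preimage, (PiLp.volume_preserving_ofLp (Fin n)).measure_preimage
    (MeasurableSet.univ_pi fun _ => measurableSet_Ioo).nullMeasurableSet, Real.volume_pi_Ioo]
  simp

theorem mem_cube_of_dist_le {n : ℕ} {a r : ℝ} {x y : EuclideanSpace ℝ (Fin n)}
    (hx : x ∈ cube n a) (h : dist y x ≤ r) : y ∈ cube n (a + 2 * r) := by
  intro i
  have h1 := hx i
  have h2 : |y i - x i| ≤ r := (PiLp.norm_apply_le (y - x) i).trans (by rwa [← dist_eq_norm])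
  have h3 := abs_add_le (y i - x i) (x i)
  rw [sub_add_cancel] at h3
  linarith

theorem mem_cube_of_norm_lt {n : ℕ} {a : ℝ} {x : EuclideanSpace ℝ (Fin n)} (h : ‖x‖ < a / 2) :
    x ∈ cube n a := fun i => (PiLp.norm_apply_le x i).trans_lt h

theorem IsIC.numPoints_ne_top {n : ℕ} {S : Set (EuclideanSpace ℝ (Fin n))} (hS : IsIC S) (a : ℝ) :
    numPoints S a ≠ ∞ := by
  rw [numPoints_eq_card (hS.2 a)]
  exact ENNReal.natCast_ne_top _

theorem eventually_numPoints_ne_zero {n : ℕ} {S : Set (EuclideanSpace ℝ (Fin n))}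
    (hS : S.Nonempty) : ∀ᶠ a in atTop, numPoints S a ≠ 0 := by
  obtain ⟨s, hs⟩ := hS
  filter_upwards [eventually_gt_atTop (2 * ‖s‖)] with a ha
  have : (S ∩ cube n a).Nonempty := ⟨s, hs, mem_cube_of_norm_lt (by linarith)⟩
  simpa [numPoints] using this.ne_empty

theorem isClosed_voronoi {n : ℕ} (S : Set (EuclideanSpace ℝ (Fin n)))
    (s : EuclideanSpace ℝ (Fin n)) : IsClosed (voronoi S s) := by
  simp only [voronoi, ofPred_forall]
  exact isClosed_biInter fun t _ => isClosed_le (by fun_prop) (by fun_prop)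

/-- Common points lie on the perpendicular bisector, a proper affine subspace. -/
theorem volume_voronoi_inter {n : ℕ} {S : Set (EuclideanSpace ℝ (Fin n))}
    {s t : EuclideanSpace ℝ (Fin n)} (hs : s ∈ S) (ht : t ∈ S) (hst : s ≠ t) :
    volume (voronoi S s ∩ voronoi S t) = 0 := by
  refine measure_mono_null (t := (AffineSubspace.perpBisector s t : Set _)) ?_
    (Measure.addHaar_affineSubspace _ _ ?_)
  · intro x hx
    exact AffineSubspace.mem_perpBisector_iff_dist_eq.2 (le_antisymm (hx.1 t ht) (hx.2 s hs))
  · rwa [Ne, AffineSubspace.perpBisector_eq_top]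

theorem sum_volume_le_of_subset_voronoi {n : ℕ} {S C : Set (EuclideanSpace ℝ (Fin n))}
    {F : Finset (EuclideanSpace ℝ (Fin n))} (hF : ↑F ⊆ S)
    {A : EuclideanSpace ℝ (Fin n) → Set (EuclideanSpace ℝ (Fin n))}
    (hA : ∀ s ∈ F, MeasurableSet (A s)) (hW : ∀ s ∈ F, A s ⊆ voronoi S s)
    (hC : ∀ s ∈ F, A s ⊆ C) : ∑ s ∈ F, volume (A s) ≤ volume C := by
  rw [← measure_biUnion_finset₀ _ fun s hs => (hA s hs).nullMeasurableSet]
  · exact measure_mono (iUnion₂_subset hC)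
  · exact fun s hs t ht hst => measure_mono_null (inter_subset_inter (hW s hs) (hW t ht))
      (volume_voronoi_inter (hF hs) (hF ht) hst)

/-- Only finitely many points of `S` are as close to `x` as a fixed `s₀`, so a nearest one exists.
-/
theorem IsIC.exists_mem_voronoi {n : ℕ} {S : Set (EuclideanSpace ℝ (Fin n))} (hS : IsIC S)
    (x : EuclideanSpace ℝ (Fin n)) : ∃ s ∈ S, x ∈ voronoi S s := by
  obtain ⟨s₀, hs₀⟩ := hS.1
  have hmem : ∀ t, dist x t ≤ dist x s₀ → t ∈ cube n (2 * (‖x‖ + dist x s₀ + 1)) := by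
    intro t ht
    refine mem_cube_of_norm_lt ?_
    have h1 : ‖t‖ ≤ ‖x‖ + dist x t := by
      rw [dist_comm, dist_eq_norm]; exact norm_le_norm_add_norm_sub' t x
    linarith
  obtain ⟨s, hs, hmin⟩ := exists_min_image _ (fun t => dist x t)
    (hS.2 (2 * (‖x‖ + dist x s₀ + 1))) ⟨s₀, hs₀, hmem s₀ le_rfl⟩
  refine ⟨s, hs.1, fun t ht => ?_⟩
  by_cases h : dist x t ≤ dist x s₀
  · exact hmin t ⟨ht, hmem t h⟩
  · exact (hmin s₀ ⟨hs₀, hmem s₀ le_rfl⟩).trans (not_le.1 h).le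

/-! ### The sphere bound -/

theorem errorProb_le_one {n : ℕ} (σ : ℝ≥0) (S : Set (EuclideanSpace ℝ (Fin n)))
    (s : EuclideanSpace ℝ (Fin n)) : errorProb σ S s ≤ 1 := prob_le_one

/-- The sphere bound for the points of a constellation in a cube, up to the tail of the noise. -/
theorem SPB_le_cubeAverage_add_tail {n : ℕ} (hn : 0 < n) {σ : ℝ≥0} (hσ : 0 < σ)
    {S : Set (EuclideanSpace ℝ (Fin n))} (hS : IsIC S) {a : ℝ} (h0 : numPoints S a ≠ 0) (r : ℝ) :
    SPB n σ (ENNReal.ofReal (a + 2 * r) ^ n / numPoints S a) ≤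
      cubeAverage S a (errorProb σ S) + noise n σ (Metric.ball 0 r)ᶜ := by
  have hfin := hS.2 a
  have htop := hS.numPoints_ne_top a
  rw [cubeAverage_eq_sum_div hfin]
  have hcard := numPoints_eq_card hfin
  set M := numPoints S a
  set F := hfin.toFinset
  have hF : ∀ s ∈ F, s ∈ S ∧ s ∈ cube n a := fun s hs => hfin.mem_toFinset.1 hs
  set A : EuclideanSpace ℝ (Fin n) → Set (EuclideanSpace ℝ (Fin n)) := fun s =>
    voronoi S s ∩ Metric.ball s r
  set D : EuclideanSpace ℝ (Fin n) → Set (EuclideanSpace ℝ (Fin n)) := fun s =>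
    (fun z => s + z) ⁻¹' A s
  have hA : ∀ s, MeasurableSet (A s) := fun s =>
    (isClosed_voronoi S s).measurableSet.inter Metric.isOpen_ball.measurableSet
  have hD : ∀ s, MeasurableSet (D s) := fun s => (hA s).preimage (by fun_prop)
  have hind : ∀ s, Measurable ((D s).indicator (1 : EuclideanSpace ℝ (Fin n) → ℝ≥0∞)) :=
    fun s => measurable_one.indicator (hD s)
  have hlint : ∀ ν : Measure (EuclideanSpace ℝ (Fin n)),
      ∫⁻ x, (∑ s ∈ F, (D s).indicator 1 x) / M ∂ν = (∑ s ∈ F, ν (D s)) / M := by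
    intro ν
    simp_rw [div_eq_mul_inv]
    rw [lintegral_mul_const _ (Finset.measurable_fun_sum _ fun s _ => hind s),
      lintegral_finsetSum _ fun s _ => hind s]
    simp_rw [lintegral_indicator_one (hD _)]
  have hvol : ∑ s ∈ F, volume (D s) ≤ ENNReal.ofReal (a + 2 * r) ^ n := by
    rw [← volume_cube]
    simp_rw [D, measure_preimage_add]
    exact sum_volume_le_of_subset_voronoi (fun s hs => (hF s hs).1) (fun s _ => hA s)
      (fun s _ => inter_subset_left)
      fun s hs x hx => mem_cube_of_dist_le (hF s hs).2 (Metric.mem_ball.1 hx.2).le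
  -- The recentred cells overlap heavily; only the number of terms is used.
  have hone : ∀ x, (∑ s ∈ F, (D s).indicator 1 x) / M ≤ 1 := by
    intro x
    refine ENNReal.div_le_of_le_mul ?_
    rw [one_mul, hcard]
    calc _ ≤ ∑ s ∈ F, (1 : ℝ≥0∞) := Finset.sum_le_sum fun s _ =>
          indicator_le_self' (by simp) x
      _ = _ := by simp
  have key := lintegral_noise_add_SPB_le hn hσ
    (v := ENNReal.ofReal (a + 2 * r) ^ n / M) (ENNReal.div_ne_top (by simp) h0)
    ((Finset.measurable_fun_sum _ fun s _ => hind s).div_const M) hone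
    (by rw [hlint]; exact ENNReal.div_le_div_right hvol _)
  rw [hlint] at key
  -- Each noise vector causes an error, stays in the truncated cell, or has norm at least `r`.
  have hpt : ∀ s ∈ F, 1 ≤ errorProb σ S s + noise n σ (D s) + noise n σ (Metric.ball 0 r)ᶜ := by
    intro s _
    rw [← measure_univ (μ := noise n σ), errorProb]
    refine (measure_mono ?_).trans
      ((measure_union_le _ _).trans (add_le_add_left (measure_union_le _ _) _))
    intro z _
    by_cases h1 : s + z ∈ voronoi S s
    · by_cases h2 : z ∈ Metric.ball 0 r
      · exact Or.inl (Or.inr ⟨h1, by simpa using h2⟩)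
      · exact Or.inr h2
    · exact Or.inl (Or.inl h1)
  have hsum := Finset.sum_le_sum hpt
  simp only [Finset.sum_add_distrib, Finset.sum_const, nsmul_eq_mul, mul_one, ← hcard] at hsum
  have hdiv := ENNReal.div_le_div_right hsum M
  rw [ENNReal.div_self h0 htop, ENNReal.add_div, ENNReal.add_div, mul_comm M,
    ENNReal.mul_div_cancel_right h0 htop] at hdiv
  have hX : (∑ s ∈ F, noise n σ (D s)) / M ≠ ∞ :=
    ((le_self_add.trans key).trans_lt ENNReal.one_lt_top).ne
  refine ENNReal.le_of_add_le_add_left hX (key.trans (hdiv.trans (le_of_eq ?_)))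
  ring

theorem ofReal_pow_div_ofReal_pow {L : ℝ} (hL : 0 < L) (x : ℝ) (n : ℕ) :
    ENNReal.ofReal x ^ n / ENNReal.ofReal L ^ n = ENNReal.ofReal (x / L) ^ n := by
  rw [ENNReal.ofReal_div_of_pos hL, div_eq_mul_inv, div_eq_mul_inv, mul_pow, ENNReal.inv_pow]

theorem tendsto_ofReal_add_pow_div (n : ℕ) (c : ℝ) :
    Tendsto (fun a : ℝ => ENNReal.ofReal (a + c) ^ n / ENNReal.ofReal a ^ n) atTop (𝓝 1) := by
  have h1 : Tendsto (fun a : ℝ => 1 + c / a) atTop (𝓝 (1 + 0)) :=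
    tendsto_const_nhds.add (tendsto_const_nhds.div_atTop tendsto_id)
  have h2 := ENNReal.Tendsto.pow (n := n) (ENNReal.tendsto_ofReal h1)
  rw [add_zero, ENNReal.ofReal_one, one_pow] at h2
  refine h2.congr' ?_
  filter_upwards [eventually_gt_atTop 0] with a ha
  have : 1 + c / a = (a + c) / a := by field_simp
  rw [this, ofReal_pow_div_ofReal_pow ha]

theorem SPB_inv_density_le_avgErrorProb {n : ℕ} (hn : 0 < n) {σ : ℝ≥0} (hσ : 0 < σ)
    {S : Set (EuclideanSpace ℝ (Fin n))} (hS : IsIC S) :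
    SPB n σ (density S)⁻¹ ≤ avgErrorProb σ S := by
  rcases eq_or_ne (density S) 0 with hγ | hγ
  · rw [hγ, ENNReal.inv_zero, SPB_top hn]
    exact zero_le
  refine SPB_le_of_forall_gt (ENNReal.inv_ne_top.2 hγ) fun w hw hwt => ?_
  have hlim : Tendsto (fun k : ℕ => avgErrorProb σ S + noise n σ (Metric.ball 0 k)ᶜ) atTop
      (𝓝 (avgErrorProb σ S + 0)) := tendsto_const_nhds.add (tendsto_noise_tail n σ)
  rw [add_zero] at hlim
  refine ge_of_tendsto' hlim fun k => ?_
  -- With `1/w < g < γ`, the slack `w g > 1` absorbs the border factor `(a + 2k)^n / a^n → 1`.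
  obtain ⟨g, hg1, hg2⟩ := exists_between (ENNReal.inv_lt_iff_inv_lt.1 hw)
  have hw0 : w ≠ 0 := (zero_le.trans_lt hw).ne'
  have h1 : 1 < w * g := by
    rw [mul_comm]
    calc 1 = w⁻¹ * w := (ENNReal.inv_mul_cancel hw0 hwt).symm
      _ < g * w := ENNReal.mul_lt_mul_left hw0 hwt hg1
  have hev := (tendsto_ofReal_add_pow_div n (2 * k)).eventually_lt_const h1
  -- The density is only a limsup, so this holds just frequently; that suffices because the average
  -- error is also a limsup.
  have hfr : ∃ᶠ a in atTop, g < numPoints S a / ENNReal.ofReal a ^ n :=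
    frequently_lt_of_lt_limsup (by isBoundedDefault) hg2
  rw [← tsub_le_iff_right]
  refine le_limsup_of_frequently_le ?_ (by isBoundedDefault)
  refine (hfr.and_eventually ((hev.and (eventually_numPoints_ne_zero hS.1)).and
    (eventually_gt_atTop 0))).mono ?_
  rintro a ⟨hga, ⟨hra, h0⟩, ha⟩
  rw [tsub_le_iff_right]
  refine le_trans (SPB_antitone n σ ?_) (SPB_le_cubeAverage_add_tail hn hσ hS h0 k)
  have ha0 : ENNReal.ofReal a ^ n ≠ 0 := by simp [ha]
  have hat : ENNReal.ofReal a ^ n ≠ ∞ := by simp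
  refine ENNReal.div_le_of_le_mul ?_
  calc ENNReal.ofReal (a + 2 * k) ^ n
      ≤ w * g * ENNReal.ofReal a ^ n := (ENNReal.div_le_iff ha0 hat).1 hra.le
    _ = w * (g * ENNReal.ofReal a ^ n) := mul_assoc _ _ _
    _ ≤ w * numPoints S a := by
        gcongr
        exact (ENNReal.le_div_iff_mul_le (Or.inl ha0) (Or.inl hat)).1 hga.le

/-! ### Average cell volume of regular constellations -/

theorem tendsto_ofReal_add_pow_div_numPoints {n : ℕ} {S : Set (EuclideanSpace ℝ (Fin n))}
    (h : Tendsto (fun a : ℝ => numPoints S a / ENNReal.ofReal a ^ n) atTop (𝓝 (density S)))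
    (c : ℝ) : Tendsto (fun a : ℝ => ENNReal.ofReal (a + c) ^ n / numPoints S a) atTop
      (𝓝 (density S)⁻¹) := by
  have := ENNReal.Tendsto.mul (tendsto_ofReal_add_pow_div n c) (Or.inl one_ne_zero)
    (tendsto_inv_iff.2 h) (Or.inr ENNReal.one_ne_top)
  rw [one_mul] at this
  refine this.congr' ?_
  filter_upwards [eventually_gt_atTop 0] with a ha
  have ha0 : ENNReal.ofReal a ^ n ≠ 0 := by simp [ha]
  have hat : ENNReal.ofReal a ^ n ≠ ∞ := by simp
  rw [ENNReal.inv_div (Or.inl hat) (Or.inl ha0), ← mul_div_assoc,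
    ENNReal.div_mul_cancel ha0 hat]

theorem IsRegular.avgVoronoiVol_eq {n : ℕ} {S : Set (EuclideanSpace ℝ (Fin n))}
    (hS : IsRegular S) : avgVoronoiVol S = (density S)⁻¹ := by
  obtain ⟨hIC, ⟨r, -, hW⟩, hlim⟩ := hS
  refine Tendsto.limsup_eq (tendsto_of_tendsto_of_tendsto_of_le_of_le
    (tendsto_ofReal_add_pow_div_numPoints hlim (-(2 * r)))
    (tendsto_ofReal_add_pow_div_numPoints hlim (2 * r)) (fun a => ?_) fun a => ?_)
  -- Lower bound: the cell containing a point of the cube of edge `a - 2r` has its centre in the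
  -- cube of edge `a`.
  · have hfin := hIC.2 a
    simp only [cubeAverage_eq_sum_div hfin]
    refine ENNReal.div_le_div_right ?_ _
    rw [← volume_cube]
    refine (measure_mono fun x hx => ?_).trans (measure_biUnion_finset_le hfin.toFinset (voronoi S))
    obtain ⟨s, hs, hxs⟩ := hIC.exists_mem_voronoi x
    refine mem_iUnion₂.2 ⟨s, hfin.mem_toFinset.2 ⟨hs, ?_⟩, hxs⟩
    have := mem_cube_of_dist_le hx (y := s) (r := r)
      (by rw [dist_comm]; exact (Metric.mem_ball.1 (hW s hs hxs)).le)
    simpa using this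
  · have hfin := hIC.2 a
    simp only [cubeAverage_eq_sum_div hfin]
    refine ENNReal.div_le_div_right ?_ _
    rw [← volume_cube]
    have hF : ∀ s ∈ hfin.toFinset, s ∈ S ∧ s ∈ cube n a := fun s hs => hfin.mem_toFinset.1 hs
    exact sum_volume_le_of_subset_voronoi (fun s hs => (hF s hs).1)
      (fun s _ => (isClosed_voronoi S s).measurableSet) (fun _ _ => subset_rfl)
      fun s hs x hx => mem_cube_of_dist_le (hF s hs).2
        (Metric.mem_ball.1 (hW s (hF s hs).1 hx)).le

/-! ### Periodic constellations -/

/-- The translate of `f` by `L` times the integer vector `k`. -/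
noncomputable def latticeShift {n : ℕ} (L : ℝ) (f : EuclideanSpace ℝ (Fin n)) (k : Fin n → ℤ) :
    EuclideanSpace ℝ (Fin n) :=
  f + WithLp.toLp 2 fun i => L * k i

@[simp]
theorem latticeShift_apply {n : ℕ} (L : ℝ) (f : EuclideanSpace ℝ (Fin n)) (k : Fin n → ℤ)
    (i : Fin n) : latticeShift L f k i = f i + L * k i := rfl

/-- The union of the translates of a finite set by `L ℤⁿ`. -/
def periodization {n : ℕ} (L : ℝ) (F : Finset (EuclideanSpace ℝ (Fin n))) :
    Set (EuclideanSpace ℝ (Fin n)) :=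
  {x | ∃ f ∈ F, ∃ k, latticeShift L f k = x}

/-- The integer vectors `k` for which `f + L k` lies in the cube of edge length `A`. -/
noncomputable def shiftsInCube {n : ℕ} (L A : ℝ) (f : EuclideanSpace ℝ (Fin n)) :
    Finset (Fin n → ℤ) :=
  Fintype.piFinset fun i => Finset.Ioo ⌊(-(A / 2) - f i) / L⌋ ⌈(A / 2 - f i) / L⌉

theorem mem_shiftsInCube {n : ℕ} {L : ℝ} (hL : 0 < L) {A : ℝ} {f : EuclideanSpace ℝ (Fin n)}
    {k : Fin n → ℤ} : k ∈ shiftsInCube L A f ↔ latticeShift L f k ∈ cube n A := by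
  simp only [shiftsInCube, Fintype.mem_piFinset, Finset.mem_Ioo, Int.floor_lt, Int.lt_ceil,
    div_lt_iff₀ hL, lt_div_iff₀ hL, cube, mem_ofPred_eq, latticeShift_apply, abs_lt]
  refine forall_congr' fun i => ⟨fun h => ⟨?_, ?_⟩, fun h => ⟨?_, ?_⟩⟩ <;>
    nlinarith [h.1, h.2]

/-- In each coordinate, an open interval of length `A / L` contains at most `A / L + 1` integers. -/
theorem card_shiftsInCube_le {n : ℕ} {L A : ℝ} (hL : 0 < L) (hA : 0 < A)
    (f : EuclideanSpace ℝ (Fin n)) :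
    ((shiftsInCube L A f).card : ℝ≥0∞) ≤ ENNReal.ofReal (A + L) ^ n / ENNReal.ofReal L ^ n := by
  rw [shiftsInCube, Fintype.card_piFinset, Nat.cast_prod, ofReal_pow_div_ofReal_pow hL]
  refine (Finset.prod_le_pow_card _ _ (ENNReal.ofReal ((A + L) / L)) fun i _ => ?_).trans (by simp)
  rw [← ENNReal.ofReal_natCast, Int.card_Ioo]
  refine ENNReal.ofReal_le_ofReal ?_
  have h1 := Int.lt_floor_add_one ((-(A / 2) - f i) / L)
  have h2 := Int.ceil_lt_add_one ((A / 2 - f i) / L)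
  have h3 : (A / 2 - f i) / L - (-(A / 2) - f i) / L = A / L := by ring
  have h4 : (A + L) / L = A / L + 1 := by field_simp
  have h5 : 0 < A / L := by positivity
  have h6 : (((⌈(A / 2 - f i) / L⌉ - ⌊(-(A / 2) - f i) / L⌋ - 1).toNat : ℤ) : ℝ) =
      max ((⌈(A / 2 - f i) / L⌉ : ℝ) - (⌊(-(A / 2) - f i) / L⌋ : ℝ) - 1) 0 := by
    rw [Int.ofNat_toNat]
    push_cast
    rfl
  rw [Int.cast_natCast] at h6
  rw [h6]
  exact max_le (by linarith) (by linarith)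

theorem le_card_shiftsInCube {n : ℕ} {L : ℝ} (hL : 0 < L) (A : ℝ)
    (f : EuclideanSpace ℝ (Fin n)) :
    ENNReal.ofReal (A + -L) ^ n / ENNReal.ofReal L ^ n ≤ ((shiftsInCube L A f).card : ℝ≥0∞) := by
  rw [shiftsInCube, Fintype.card_piFinset, Nat.cast_prod, ofReal_pow_div_ofReal_pow hL]
  refine le_trans (by simp) (Finset.prod_le_prod' (f := fun _ => ENNReal.ofReal ((A + -L) / L))
    fun i _ => ?_)
  rw [← ENNReal.ofReal_natCast, Int.card_Ioo]
  refine ENNReal.ofReal_le_ofReal ?_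
  have h1 := Int.floor_le ((-(A / 2) - f i) / L)
  have h2 := Int.le_ceil ((A / 2 - f i) / L)
  have h3 : (A / 2 - f i) / L - (-(A / 2) - f i) / L = A / L := by ring
  have h4 : (A + -L) / L = A / L - 1 := by field_simp; ring
  have h6 : (((⌈(A / 2 - f i) / L⌉ - ⌊(-(A / 2) - f i) / L⌋ - 1 : ℤ)) : ℝ) ≤
      (((⌈(A / 2 - f i) / L⌉ - ⌊(-(A / 2) - f i) / L⌋ - 1).toNat : ℤ) : ℝ) :=
    Int.cast_le.2 (Int.self_le_toNat _)
  rw [Int.cast_natCast] at h6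
  push_cast at h6
  linarith

/-- In a coordinate where `k` and `k'` differ, the shifts are at least `a + b` apart, while `f` and
`f'` differ by less than `a`. This is the guard gap. -/
theorem le_dist_latticeShift {n : ℕ} {a b : ℝ} (hb : 0 < b)
    {f f' : EuclideanSpace ℝ (Fin n)} (hf : f ∈ cube n a) (hf' : f' ∈ cube n a)
    {k k' : Fin n → ℤ} (hk : k ≠ k') :
    b ≤ dist (latticeShift (a + b) f k) (latticeShift (a + b) f' k') := by
  obtain ⟨i, hi⟩ := Function.ne_iff.1 hk
  rw [dist_eq_norm]
  refine le_trans ?_ (PiLp.norm_apply_le _ i)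
  have h1 := abs_lt.1 (hf i)
  have h2 := abs_lt.1 (hf' i)
  rw [Real.norm_eq_abs, PiLp.sub_apply, latticeShift_apply, latticeShift_apply, le_abs]
  rcases lt_or_gt_of_ne hi with h | h
  · right
    have h3 : ((k i : ℝ)) + 1 ≤ k' i := by exact_mod_cast h
    nlinarith
  · left
    have h3 : ((k' i : ℝ)) + 1 ≤ k i := by exact_mod_cast h
    nlinarith

theorem latticeShift_injOn {n : ℕ} {a b : ℝ} (hb : 0 < b)
    {f f' : EuclideanSpace ℝ (Fin n)} (hf : f ∈ cube n a) (hf' : f' ∈ cube n a)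
    {k k' : Fin n → ℤ} (h : latticeShift (a + b) f k = latticeShift (a + b) f' k') :
    f = f' ∧ k = k' := by
  have hk : k = k' := by
    by_contra hk
    have := le_dist_latticeShift hb hf hf' hk
    rw [h, dist_self] at this
    linarith
  subst hk
  exact ⟨add_right_cancel h, rfl⟩

theorem periodization_inter_cube {n : ℕ} {L : ℝ} (hL : 0 < L)
    (F : Finset (EuclideanSpace ℝ (Fin n))) (A : ℝ) :
    periodization L F ∩ cube n A =
      (fun p : (_ : EuclideanSpace ℝ (Fin n)) × (Fin n → ℤ) => latticeShift L p.1 p.2) ''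
        (F.sigma (shiftsInCube L A) : Finset _) := by
  ext x
  constructor
  · rintro ⟨⟨f, hf, k, rfl⟩, hx⟩
    exact ⟨⟨f, k⟩, by simpa using ⟨hf, (mem_shiftsInCube hL).2 hx⟩, rfl⟩
  · rintro ⟨⟨f, k⟩, hp, rfl⟩
    rw [Finset.mem_coe, Finset.mem_sigma] at hp
    exact ⟨⟨f, hp.1, k, rfl⟩, (mem_shiftsInCube hL).1 hp.2⟩

theorem finite_periodization_inter_cube {n : ℕ} {L : ℝ} (hL : 0 < L)
    (F : Finset (EuclideanSpace ℝ (Fin n))) (A : ℝ) : (periodization L F ∩ cube n A).Finite := by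
  rw [periodization_inter_cube hL]
  exact (Finset.finite_toSet _).image _

theorem isIC_periodization {n : ℕ} {L : ℝ} (hL : 0 < L)
    {F : Finset (EuclideanSpace ℝ (Fin n))} (hF : F.Nonempty) : IsIC (periodization L F) := by
  obtain ⟨f, hf⟩ := hF
  exact ⟨⟨_, f, hf, 0, rfl⟩, finite_periodization_inter_cube hL F⟩

theorem sum_periodization_inter_cube {n : ℕ} {a b : ℝ} (hb : 0 < b) (hL : 0 < a + b)
    {F : Finset (EuclideanSpace ℝ (Fin n))} (hF : ∀ f ∈ F, f ∈ cube n a) (A : ℝ)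
    (g : EuclideanSpace ℝ (Fin n) → ℝ≥0∞) :
    ∑ s ∈ (finite_periodization_inter_cube hL F A).toFinset, g s =
      ∑ f ∈ F, ∑ k ∈ shiftsInCube (a + b) A f, g (latticeShift (a + b) f k) := by
  classical
  have h : (finite_periodization_inter_cube hL F A).toFinset =
      (F.sigma (shiftsInCube (a + b) A)).image
        (fun p : (_ : EuclideanSpace ℝ (Fin n)) × (Fin n → ℤ) =>
          latticeShift (a + b) p.1 p.2) := by
    rw [← Finset.coe_inj, Finset.coe_image, Finite.coe_toFinset, periodization_inter_cube hL]
  rw [h, Finset.sum_image, Finset.sum_sigma]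
  rintro ⟨f, k⟩ hp ⟨f', k'⟩ hp' heq
  rw [Finset.mem_coe, Finset.mem_sigma] at hp hp'
  obtain ⟨rfl, rfl⟩ := latticeShift_injOn hb (hF _ hp.1) (hF _ hp'.1) heq
  rfl

theorem numPoints_periodization {n : ℕ} {a b : ℝ} (hb : 0 < b) (hL : 0 < a + b)
    {F : Finset (EuclideanSpace ℝ (Fin n))} (hF : ∀ f ∈ F, f ∈ cube n a) (A : ℝ) :
    numPoints (periodization (a + b) F) A = ∑ f ∈ F, ((shiftsInCube (a + b) A f).card : ℝ≥0∞) := by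
  have := sum_periodization_inter_cube hb hL hF A 1
  simp only [Pi.one_apply, Finset.sum_const, nsmul_eq_mul, mul_one] at this
  rw [numPoints_eq_card (finite_periodization_inter_cube hL F A), this]

theorem tendsto_numPoints_periodization {n : ℕ} {a b : ℝ} (hb : 0 < b) (hL : 0 < a + b)
    {F : Finset (EuclideanSpace ℝ (Fin n))} (hF : ∀ f ∈ F, f ∈ cube n a) :
    Tendsto (fun A : ℝ => numPoints (periodization (a + b) F) A / ENNReal.ofReal A ^ n) atTop
      (𝓝 (F.card / ENNReal.ofReal (a + b) ^ n)) := by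
  have hlim : ∀ c : ℝ, Tendsto (fun A : ℝ => (F.card / ENNReal.ofReal (a + b) ^ n : ℝ≥0∞) *
      (ENNReal.ofReal (A + c) ^ n / ENNReal.ofReal A ^ n)) atTop
      (𝓝 (F.card / ENNReal.ofReal (a + b) ^ n)) := by
    intro c
    have := ENNReal.Tendsto.const_mul (tendsto_ofReal_add_pow_div n c)
      (Or.inl one_ne_zero) (a := (F.card / ENNReal.ofReal (a + b) ^ n : ℝ≥0∞))
    rwa [mul_one] at this
  have hcomm : ∀ x y : ℝ≥0∞, (F.card / ENNReal.ofReal (a + b) ^ n : ℝ≥0∞) * (x / y) =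
      (∑ _f ∈ F, x / ENNReal.ofReal (a + b) ^ n) / y := by
    intro x y
    simp only [Finset.sum_const, nsmul_eq_mul, div_eq_mul_inv]
    ring
  refine tendsto_of_tendsto_of_tendsto_of_le_of_le' (hlim (-(a + b))) (hlim (a + b)) ?_ ?_
  · refine Eventually.of_forall fun A => ?_
    rw [hcomm, numPoints_periodization hb hL hF]
    exact ENNReal.div_le_div_right (Finset.sum_le_sum fun f _ => le_card_shiftsInCube hL A f) _
  · filter_upwards [eventually_gt_atTop 0] with A hA
    rw [hcomm, numPoints_periodization hb hL hF]
    exact ENNReal.div_le_div_right (Finset.sum_le_sum fun f _ => card_shiftsInCube_le hL hA f) _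

theorem density_periodization {n : ℕ} {a b : ℝ} (hb : 0 < b) (hL : 0 < a + b)
    {F : Finset (EuclideanSpace ℝ (Fin n))} (hF : ∀ f ∈ F, f ∈ cube n a) :
    density (periodization (a + b) F) = F.card / ENNReal.ofReal (a + b) ^ n :=
  (tendsto_numPoints_periodization hb hL hF).limsup_eq

theorem voronoi_periodization_subset_ball {n : ℕ} {L : ℝ} (hL : 0 < L)
    {F : Finset (EuclideanSpace ℝ (Fin n))} (hF : F.Nonempty) (s : EuclideanSpace ℝ (Fin n)) :
    voronoi (periodization L F) s ⊆ Metric.ball s (√(n * L ^ 2) + 1) := by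
  obtain ⟨f, hf⟩ := hF
  intro x hx
  rw [Metric.mem_ball]
  -- Rounding down coordinatewise gives a translate of `f` within `L` of `x` in each coordinate; the
  -- `+ 1` in the radius makes the ball open.
  refine lt_of_le_of_lt ((hx _ ⟨f, hf, fun i => ⌊(x i - f i) / L⌋, rfl⟩).trans ?_)
    (lt_add_one _)
  rw [EuclideanSpace.dist_eq]
  refine Real.sqrt_le_sqrt ?_
  calc _ ≤ ∑ _i : Fin n, L ^ 2 := by
        refine Finset.sum_le_sum fun i _ => ?_
        rw [Real.dist_eq, sq_abs, latticeShift_apply]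
        have h1 := (le_div_iff₀ hL).1 (Int.floor_le ((x i - f i) / L))
        have h2 := (div_lt_iff₀ hL).1 (Int.lt_floor_add_one ((x i - f i) / L))
        exact pow_le_pow_left₀ (by linarith) (by linarith) 2
    _ = n * L ^ 2 := by simp

theorem isRegular_periodization {n : ℕ} {a b : ℝ} (hb : 0 < b) (hL : 0 < a + b)
    {F : Finset (EuclideanSpace ℝ (Fin n))} (hF : ∀ f ∈ F, f ∈ cube n a) (hne : F.Nonempty) :
    IsRegular (periodization (a + b) F) :=
  ⟨isIC_periodization hL hne,
    ⟨_, by positivity, fun s _ => voronoi_periodization_subset_ball hL hne s⟩,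
    (density_periodization hb hL hF).symm ▸ tendsto_numPoints_periodization hb hL hF⟩

/-! ### Error probability after periodization, and regularization -/

/-- Points of the same block come from `S` and compete as before; those of other blocks are at
distance at least `b`, so they cannot win when `‖z‖ < b / 2`. -/
theorem errorProb_periodization_le {n : ℕ} (σ : ℝ≥0) {S : Set (EuclideanSpace ℝ (Fin n))}
    {a b : ℝ} (hb : 0 < b) {F : Finset (EuclideanSpace ℝ (Fin n))}
    (hF : ∀ f ∈ F, f ∈ cube n a) (hFS : ∀ f ∈ F, f ∈ S) {f : EuclideanSpace ℝ (Fin n)}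
    (hf : f ∈ F) (k : Fin n → ℤ) :
    errorProb σ (periodization (a + b) F) (latticeShift (a + b) f k) ≤
      errorProb σ S f + noise n σ (Metric.ball 0 (b / 2))ᶜ := by
  refine (measure_mono fun z hz => ?_).trans (measure_union_le _ _)
  by_contra hcon
  rw [mem_union, not_or, mem_compl_iff, not_not, mem_ball_zero_iff] at hcon
  obtain ⟨h1, h2⟩ := hcon
  have h1 : f + z ∈ voronoi S f := not_not.1 h1
  refine hz ?_
  rintro t ⟨f', hf', k', rfl⟩
  rw [dist_self_add_left]
  by_cases hk : k = k'
  · subst hk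
    have h3 := h1 f' (hFS f' hf')
    rw [dist_self_add_left] at h3
    rwa [latticeShift, latticeShift, add_right_comm, dist_add_right]
  · have h3 := le_dist_latticeShift hb (hF f hf) (hF f' hf') hk
    have h4 := dist_triangle_left (latticeShift (a + b) f k) (latticeShift (a + b) f' k')
      (latticeShift (a + b) f k + z)
    rw [dist_self_add_left] at h4
    linarith

/-- The bound `B f` does not depend on the shift, and all `f ∈ F` have asymptotically equally many
translates in a large cube. -/
theorem avgErrorProb_periodization_le {n : ℕ} (σ : ℝ≥0) {a b : ℝ} (hb : 0 < b) (hL : 0 < a + b)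
    {F : Finset (EuclideanSpace ℝ (Fin n))} (hF : ∀ f ∈ F, f ∈ cube n a) (hne : F.Nonempty)
    {B : EuclideanSpace ℝ (Fin n) → ℝ≥0∞} (hBt : ∀ f ∈ F, B f ≠ ∞)
    (hB : ∀ f ∈ F, ∀ k,
      errorProb σ (periodization (a + b) F) (latticeShift (a + b) f k) ≤ B f) :
    avgErrorProb σ (periodization (a + b) F) ≤ (∑ f ∈ F, B f) / F.card := by
  set S := periodization (a + b) F
  have hL0 : ENNReal.ofReal (a + b) ^ n ≠ 0 := by simp [hL]
  have hLt : ENNReal.ofReal (a + b) ^ n ≠ ∞ := by simp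
  have hreg := isRegular_periodization hb hL hF hne
  have hG : (∑ f ∈ F, B f) / ENNReal.ofReal (a + b) ^ n ≠ ∞ :=
    ENNReal.div_ne_top (ENNReal.sum_ne_top.2 hBt) hL0
  have hlim := ENNReal.Tendsto.const_mul
    (tendsto_ofReal_add_pow_div_numPoints hreg.2.2 (a + b)) (Or.inr hG)
  have hval : (∑ f ∈ F, B f) / ENNReal.ofReal (a + b) ^ n * (density S)⁻¹ =
      (∑ f ∈ F, B f) / F.card := by
    rw [density_periodization hb hL hF, ENNReal.inv_div (Or.inl hLt) (Or.inl hL0),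
      ← mul_div_assoc, ENNReal.div_mul_cancel hL0 hLt]
  rw [← hval, ← hlim.limsup_eq]
  refine limsup_le_limsup ?_
  filter_upwards [eventually_gt_atTop 0] with A hA
  rw [cubeAverage_eq_sum_div (finite_periodization_inter_cube hL F A), ← mul_div_assoc]
  refine ENNReal.div_le_div_right ?_ _
  rw [sum_periodization_inter_cube hb hL hF]
  calc _ ≤ ∑ f ∈ F, ((shiftsInCube (a + b) A f).card : ℝ≥0∞) * B f := by
        refine Finset.sum_le_sum fun f hf => ?_
        rw [← nsmul_eq_mul]
        exact Finset.sum_le_card_nsmul _ _ _ fun k _ => hB f hf k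
    _ ≤ ∑ f ∈ F, ENNReal.ofReal (A + (a + b)) ^ n / ENNReal.ofReal (a + b) ^ n * B f := by
        gcongr with f hf
        exact card_shiftsInCube_le hL hA f
    _ = _ := by
        rw [← Finset.mul_sum]
        simp only [div_eq_mul_inv]
        ring

theorem avgErrorProb_le_one {n : ℕ} (σ : ℝ≥0) {S : Set (EuclideanSpace ℝ (Fin n))}
    (hS : IsIC S) : avgErrorProb σ S ≤ 1 := by
  refine limsup_le_of_le (by isBoundedDefault) (Eventually.of_forall fun a => ?_)
  rw [cubeAverage_eq_sum_div (hS.2 a)]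
  refine ENNReal.div_le_of_le_mul ?_
  rw [one_mul, numPoints_eq_card (hS.2 a)]
  exact (Finset.sum_le_card_nsmul _ _ 1 fun s _ => errorProb_le_one σ S s).trans (by simp)

theorem exists_isRegular_density_ge_avgErrorProb_le {n : ℕ} (hn : 0 < n) {σ : ℝ≥0} (hσ : 0 < σ)
    {S : Set (EuclideanSpace ℝ (Fin n))} (hS : IsIC S) (h0 : 0 < density S) (ht : density S < ∞)
    {ξ : ℝ} (hξ : 0 < ξ) :
    ∃ S' : Set (EuclideanSpace ℝ (Fin n)), IsRegular S' ∧
      density S / ENNReal.ofReal (1 + ξ) ≤ density S' ∧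
      avgErrorProb σ S' ≤ avgErrorProb σ S * ENNReal.ofReal (1 + ξ) := by
  -- A multiplicative margin `1 + ξ` is useful only if the error is positive, which the sphere bound
  -- guarantees.
  have hp0 : avgErrorProb σ S ≠ 0 := ((SPB_pos hn hσ (ENNReal.inv_ne_top.2 h0.ne')).trans_le
    (SPB_inv_density_le_avgErrorProb hn hσ hS)).ne'
  have hpt : avgErrorProb σ S ≠ ∞ := ((avgErrorProb_le_one σ hS).trans_lt ENNReal.one_lt_top).ne
  have hc1 : 1 < ENNReal.ofReal (1 + ξ) := by
    rw [← ENNReal.ofReal_one]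
    exact (ENNReal.ofReal_lt_ofReal_iff (by linarith)).2 (by linarith)
  have hct : ENNReal.ofReal (1 + ξ) ≠ ∞ := ENNReal.ofReal_ne_top
  set c := ENNReal.ofReal (1 + ξ)
  have hc0 : c ≠ 0 := (zero_lt_one.trans hc1).ne'
  obtain ⟨p, hp1, hp2⟩ : ∃ p, avgErrorProb σ S < p ∧ p < avgErrorProb σ S * c := by
    refine exists_between ?_
    conv_lhs => rw [← mul_one (avgErrorProb σ S)]
    exact ENNReal.mul_lt_mul_right hp0 hpt hc1
  obtain ⟨k, hk, hk0⟩ : ∃ k : ℕ, p + noise n σ (Metric.ball 0 k)ᶜ < avgErrorProb σ S * c ∧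
      0 < k := by
    have hlim : Tendsto (fun k : ℕ => p + noise n σ (Metric.ball 0 k)ᶜ) atTop (𝓝 (p + 0)) :=
      tendsto_const_nhds.add (tendsto_noise_tail n σ)
    rw [add_zero] at hlim
    exact ((hlim.eventually_lt_const hp2).and (eventually_gt_atTop 0)).exists
  have hb : (0 : ℝ) < 2 * k := by positivity
  have hd : density S / c < density S := by
    refine ENNReal.div_lt_of_lt_mul ?_
    conv_lhs => rw [← mul_one (density S)]
    exact ENNReal.mul_lt_mul_right h0.ne' ht.ne hc1
  have hd0 : density S / c ≠ 0 := ENNReal.div_ne_zero.2 ⟨h0.ne', hct⟩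
  have hdt : density S / c ≠ ∞ := ENNReal.div_ne_top ht.ne hc0
  -- The slack between `γ / c` and `g` pays for the guard gap of width `2k`; the slack above `p` has
  -- already paid for the noise tail beyond `k`.
  obtain ⟨g, hg1, hg2⟩ := exists_between hd
  have h1 : 1 < g / (density S / c) := by
    rwa [ENNReal.lt_div_iff_mul_lt (Or.inl hd0) (Or.inl hdt), one_mul]
  have hfr : ∃ᶠ a in atTop, g < numPoints S a / ENNReal.ofReal a ^ n :=
    frequently_lt_of_lt_limsup (by isBoundedDefault) hg2
  have hev : ∀ᶠ a in atTop, cubeAverage S a (errorProb σ S) < p :=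
    eventually_lt_of_limsup_lt hp1 (by isBoundedDefault)
  -- High density occurs frequently and low error eventually, so a single `a` has both.
  obtain ⟨a, hga, ⟨hpa, hra⟩, ha⟩ := (hfr.and_eventually ((hev.and
    ((tendsto_ofReal_add_pow_div n (2 * k)).eventually_lt_const h1)).and
    (eventually_gt_atTop 0))).exists
  have ha0 : ENNReal.ofReal a ^ n ≠ 0 := by simp [ha]
  have hat : ENNReal.ofReal a ^ n ≠ ∞ := by simp
  have hL : 0 < a + 2 * k := by positivity
  have hL0 : ENNReal.ofReal (a + 2 * k) ^ n ≠ 0 := by simp [hL]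
  have hLt : ENNReal.ofReal (a + 2 * k) ^ n ≠ ∞ := by simp
  have hfin := hS.2 a
  have hcard := numPoints_eq_card hfin
  have hF : ∀ f ∈ hfin.toFinset, f ∈ S ∧ f ∈ cube n a := fun s hs => hfin.mem_toFinset.1 hs
  have hM0 : numPoints S a ≠ 0 := fun h => by simp [h] at hga
  have hne : hfin.toFinset.Nonempty := by
    rw [← Finset.card_ne_zero]
    intro h
    simp [hcard, h] at hM0
  refine ⟨periodization (a + 2 * k) hfin.toFinset,
    isRegular_periodization hb hL (fun f hf => (hF f hf).2) hne, ?_, ?_⟩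
  · rw [density_periodization hb hL fun f hf => (hF f hf).2, ← hcard,
      ENNReal.le_div_iff_mul_le (Or.inl hL0) (Or.inl hLt)]
    calc density S / c * ENNReal.ofReal (a + 2 * k) ^ n
        ≤ density S / c * (g / (density S / c) * ENNReal.ofReal a ^ n) := by
          gcongr
          exact (ENNReal.div_le_iff ha0 hat).1 hra.le
      _ = g * ENNReal.ofReal a ^ n := by
          rw [← mul_assoc, ENNReal.mul_div_cancel hd0 hdt]
      _ ≤ numPoints S a := (ENNReal.le_div_iff_mul_le (Or.inl ha0) (Or.inl hat)).1 hga.le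
  · refine (avgErrorProb_periodization_le σ hb hL (fun f hf => (hF f hf).2) hne
      (fun f _ => ENNReal.add_ne_top.2 ⟨measure_ne_top _ _, measure_ne_top _ _⟩)
      fun f hf k => errorProb_periodization_le σ hb (fun f hf => (hF f hf).2)
        (fun f hf => (hF f hf).1) hf k).trans (le_trans ?_ hk.le)
    rw [Finset.sum_add_distrib, ENNReal.add_div, Finset.sum_const, nsmul_eq_mul, ← hcard,
      ← cubeAverage_eq_sum_div hfin, mul_comm,
      ENNReal.mul_div_cancel_right hM0 (hS.numPoints_ne_top a), mul_div_cancel_left₀ _ two_ne_zero]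
    exact add_le_add_left hpa.le _

end InfConst

theorem mainTheorem2 (n : ℕ) (hn : 0 < n) (σ : ℝ≥0) (hσ : 0 < σ) :
    -- the sphere bound for arbitrary infinite constellations
    (∀ S : Set (EuclideanSpace ℝ (Fin n)), InfConst.IsIC S →
      InfConst.SPB n σ (InfConst.density S)⁻¹ ≤ InfConst.avgErrorProb σ S ∧
      (0 < InfConst.density S → InfConst.density S < ⊤ →
        InfConst.SPB n σ (InfConst.density S)⁻¹ =
          InfConst.sphereBound n σ (InfConst.nld S))) ∧
    -- the average Voronoi cell volume of a regular constellation
    (∀ S : Set (EuclideanSpace ℝ (Fin n)), InfConst.IsRegular S →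
      InfConst.density S = (InfConst.avgVoronoiVol S)⁻¹) ∧
    -- convexity of the sphere bound in the volume
    ConvexOn ℝ (Set.Ici 0) (fun v : ℝ => (InfConst.SPB n σ (ENNReal.ofReal v)).toReal) ∧
    -- the sphere bound for regular constellations
    (∀ S : Set (EuclideanSpace ℝ (Fin n)), InfConst.IsRegular S →
      InfConst.SPB n σ (InfConst.avgVoronoiVol S) ≤ InfConst.avgErrorProb σ S ∧
      InfConst.SPB n σ (InfConst.avgVoronoiVol S) =
        InfConst.SPB n σ (InfConst.density S)⁻¹) ∧
    -- regularization
    (∀ S : Set (EuclideanSpace ℝ (Fin n)), InfConst.IsIC S →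
      0 < InfConst.density S → InfConst.density S < ⊤ →
      ∀ ξ : ℝ, 0 < ξ → ∃ S' : Set (EuclideanSpace ℝ (Fin n)), InfConst.IsRegular S' ∧
        InfConst.density S / ENNReal.ofReal (1 + ξ) ≤ InfConst.density S' ∧
        InfConst.avgErrorProb σ S' ≤ InfConst.avgErrorProb σ S * ENNReal.ofReal (1 + ξ)) := by
  refine ⟨fun S hS => ⟨InfConst.SPB_inv_density_le_avgErrorProb hn hσ hS,
    InfConst.SPB_inv_density_eq_sphereBound σ⟩, fun S hS => ?_, InfConst.convexOn_SPB hn hσ,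
    fun S hS => ?_, fun S hS h0 ht ξ hξ =>
      InfConst.exists_isRegular_density_ge_avgErrorProb_le hn hσ hS h0 ht hξ⟩
  · rw [hS.avgVoronoiVol_eq, inv_inv]
  · rw [hS.avgVoronoiVol_eq]
    exact ⟨InfConst.SPB_inv_density_le_avgErrorProb hn hσ hS.1, rfl⟩
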